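/- Let $X$ be a real reflexive Banach space with dual $X^*$ and dual pairing $\langle\cdot,\cdot\rangle$, and identify $(X\times X^*)^*$ with $X^*\times X$ by letting $(x^*,x)$ act as $(y,y^*)\mapsto\langle y,x^*\rangle+\langle x,y^*\rangle$. For a set-valued operator $A\colon X\rightrightarrows X^*$ let $\operatorname{gra}A=\{(x,x^*)\mid x^*\in Ax\}$; $A$ is monotone if $\langle x-y,x^*-y^*\rangle\ge 0$ for all $(x,x^*),(y,y^*)\in\operatorname{gra}A$, and maximal monotone if moreover no monotone operator has a graph properly containing $\operatorname{gra}A$. The operator $-B$ has values $(-B)x=-(Bx)$. The Fitzpatrick function of $A$ is $$F_A(x,x^*)=\sup_{(a,a^*)\in\operatorname{gra}A}\big(\langle x,a^*\rangle+\langle a,x^*\rangle-\langle a,a^*\rangle\big).$$ For $F\colon X\times X^*\to\,]-\infty,+\infty]$ put $\operatorname{dom}F=\{F<+\infty\}$, $\widehat F(x,x^*)=F(x,-x^*)$, and $F^*(x^*,x)=\sup_{(y,y^*)\in X\times X^*}\big(\langle y,x^*\rangle+\langle x,y^*\rangle-F(y,y^*)\big)$. Such an $F$ is a representative of a maximal monotone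 operator $A$ if it is lower semicontinuous and convex, $F(x,x^*)\ge\langle x,x^*\rangle$ and $F^*(x^*,x)\ge\langle x,x^*\rangle$ for all $(x,x^*)\in X\times X^*$, and $\operatorname{gra}A=\{(x,x^*)\mid F(x,x^*)=\langle x,x^*\rangle\}$. For a subset $D$ of a real normed space let $${}^{i}D=\{a\in D\mid \forall x\in\operatorname{aff}(D-D)\ \exists\delta>0\ \forall\lambda\in[0,\delta]:\ a+\lambda x\in D\},$$ and let ${}^{ic}D={}^{i}D$ if the affine hull $\operatorname{aff}D$ is closed, ${}^{ic}D=\varnothing$ otherwise. Differences of sets are Minkowski differences. **Theorem.** Let $A,B\colon X\rightrightarrows X^*$ be maximal monotone with ${}^{ic}[\operatorname{conv}(\operatorname{gra}A-\operatorname{gra}(-B))]\neq\varnothing$. Then $${}^{ic}[\operatorname{gra}A-\operatorname{gra}(-B)]={}^{ic}[\operatorname{conv}(\operatorname{gra}A-\operatorname{gra}(-B))]={}^{ic}[\operatorname{dom}F_A-\operatorname{dom}\widehat{F_B}].$$ Moreover, if $F_1$ and $F_2$ are representatives of $A$ and $B$, respectively, then $${}^{ic}[\operatorname{dom}F_1-\operatorname{dom}\widehat{F_2}]={}^{ic}[\operatorname{conv}(\operatorname{gra}A-\operatorname{gra}(-B))]={}^{ic}[\operatorname{dom}F_A-\operatorname{dom}\widehat{F_B}].$$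 -/

import Mathlib

open scoped Pointwise

noncomputable section

namespace MaxMonotone

section Operators

variable {X : Type*} [NormedAddCommGroup X] [NormedSpace ℝ X]

/-- Reflexivity: the canonical map of `X` into its bidual is onto. -/
def IsReflexive (X : Type*) [NormedAddCommGroup X] [NormedSpace ℝ X] : Prop :=
  Function.Surjective (NormedSpace.inclusionInDoubleDual ℝ X)

/-- The graph of a set-valued operator from `X` to its dual. -/
def gra (A : X → Set (StrongDual ℝ X)) : Set (X × StrongDual ℝ X) :=
  {p | p.2 ∈ A p.1}

/-- Monotonicity: `⟨x - y, x* - y*⟩ ≥ 0` for all `(x, x*)`, `(y, y*)` in the graph. -/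
def IsMonotone (A : X → Set (StrongDual ℝ X)) : Prop :=
  ∀ p ∈ gra A, ∀ q ∈ gra A, 0 ≤ (p.2 - q.2) (p.1 - q.1)

/-- Maximal monotonicity: monotone, with no proper monotone extension in the sense of graphs. -/
def IsMaximalMonotone (A : X → Set (StrongDual ℝ X)) : Prop :=
  IsMonotone A ∧
    ∀ A' : X → Set (StrongDual ℝ X), IsMonotone A' → gra A ⊆ gra A' → gra A' = gra A

/-- The Fitzpatrick function
`F_A (x, x*) = sup {⟨x, a*⟩ + ⟨a, x*⟩ - ⟨a, a*⟩ : (a, a*) ∈ gra A}`. -/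
def fitzpatrick (A : X → Set (StrongDual ℝ X)) (p : X × StrongDual ℝ X) : EReal :=
  ⨆ a ∈ gra A, ((a.2 p.1 + p.2 a.1 - a.2 a.1 : ℝ) : EReal)

/-- The function `(x, x*) ↦ F (x, -x*)`. -/
def hat (F : X × StrongDual ℝ X → EReal) : X × StrongDual ℝ X → EReal :=
  fun p => F (p.1, -p.2)

end Operators

section Functions

variable {E : Type*} [NormedAddCommGroup E] [NormedSpace ℝ E]

/-- The effective domain of an extended-real-valued function. -/
def dom {E : Type*} (f : E → EReal) : Set E := {x | f x < ⊤}

/-- Convexity of an extended-real-valued function: its epigraph in `E × ℝ` is convex. -/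
def IsConvexFun (f : E → EReal) : Prop :=
  Convex ℝ {p : E × ℝ | f p.1 ≤ (p.2 : EReal)}

/-- The Fenchel conjugate `f* (φ) = sup {φ x - f x : x ∈ E}`, on the dual of `E`. -/
def fenchelConj (f : E → EReal) (φ : StrongDual ℝ E) : EReal :=
  ⨆ x, ((φ x : ℝ) : EReal) - f x

/-- The intrinsic core (relative algebraic interior) of a set. -/
def intrinsicCore (D : Set E) : Set E :=
  {a | a ∈ D ∧ ∀ x ∈ affineSpan ℝ (D - D), ∃ δ : ℝ, 0 < δ ∧ ∀ t ∈ Set.Icc 0 δ, a + t • x ∈ D}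

/-- The set `^{ic}D`: the intrinsic core of `D` if the affine hull of `D` is closed,
and the empty set otherwise. -/
def ic (D : Set E) : Set E :=
  {a | IsClosed (affineSpan ℝ D : Set E) ∧ a ∈ intrinsicCore D}

end Functions

section Representatives

variable {X : Type*} [NormedAddCommGroup X] [NormedSpace ℝ X]

/-- The functional `(y, y*) ↦ ⟨y, x*⟩ + ⟨x, y*⟩` on `X × X*` given by `(x*, x)`; for reflexive `X`
this identifies `X* × X` with the dual of `X × X*`. -/
def pairFunctional (x' : StrongDual ℝ X) (x : X) : StrongDual ℝ (X × StrongDual ℝ X) :=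
  x'.coprod (NormedSpace.inclusionInDoubleDual ℝ X x)

/-- `F : X × X* → ]-∞, +∞]` is a representative of `A`: it is lower semicontinuous and convex,
`F ≥ ⟨·,·⟩` on `X × X*`, `F* ≥ ⟨·,·⟩` on `X* × X`, and `gra A = {F = ⟨·,·⟩}`.
(That `F` never takes the value `-∞` is part of the inequality `F ≥ ⟨·,·⟩`.) -/
structure IsRepresentative (F : X × StrongDual ℝ X → EReal) (A : X → Set (StrongDual ℝ X)) :
    Prop where
  lsc : LowerSemicontinuous F
  convex : IsConvexFun F
  le : ∀ (x : X) (x' : StrongDual ℝ X), ((x' x : ℝ) : EReal) ≤ F (x, x')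
  le_conj : ∀ (x : X) (x' : StrongDual ℝ X),
    ((x' x : ℝ) : EReal) ≤ fenchelConj F (pairFunctional x' x)
  gra_eq : gra A = {p | F p = ((p.2 p.1 : ℝ) : EReal)}

end Representatives

end MaxMonotone

end

/-! Every set in the theorem lies between `S₀ = gra A - gra (-B)` and the convex set `S₂ = dom F_A -
dom (hat F_B)`; for representatives this is because `F ≥ F_A`. It therefore suffices to prove that
`ic S₂ ⊆ S₀` and that `S₂` lies in the affine hull of `S₀`; `ic_eq_of_subset_of_subset` then
identifies all the intrinsic cores.

For `ic S₂ ⊆ S₀`, translate the chosen point to zero. Both Fitzpatrick functions dominate the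
pairing, and reflection changes its sign, so `F_A + hat F_B ≥ 0`. Attouch-Brezis duality
(`exists_dual_le_add`) gives a functional, by reflexivity a pair `(w, w')`, with `F_A (w, w') + F_B
(w, -w') ≤ 0`. Both functions then equal the pairing, so `(w, w')` lies on the first graph and its
reflection on the second (`exists_mem_reflect_mem`).

For the hulls, a point of `S₂` off the closed hull of `S₀` would be separated by a pair `(w, w')`
that is constant on each graph. Maximality forces `w' w = 0` and makes each graph invariant along a
line, and that invariance confines the Fitzpatrick domains to the same hyperplanes
(`eq_of_mem_fitzpatrickEpi`). -/

namespace MaxMonotone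

/-! ### Open mapping theorem for closed convex processes. -/

section ClosedConvexProcesses

variable {V G : Type*} [NormedAddCommGroup V] [NormedSpace ℝ V]
  [NormedAddCommGroup G] [NormedSpace ℝ G]

/-- A closed convex absorbing set in a Banach space is a neighbourhood of zero. -/
theorem exists_ball_subset_of_absorbing [CompleteSpace G] {C : Set G} (hconv : Convex ℝ C)
    (hcl : IsClosed C) (hzero : (0 : G) ∈ C) (habs : ∀ u : G, ∃ t : ℝ, 0 < t ∧ t • u ∈ C) :
    ∃ ρ : ℝ, 0 < ρ ∧ Metric.ball (0 : G) ρ ⊆ C := by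
  -- Baire: countably many closed dilates cover the space, so `C` has an interior point `a`. Zero
  -- lies strictly between `a` and some `t • -a` in `C`, hence is interior.
  have hcover : (⋃ n : ℕ, ((n : ℝ) + 1) • C) = Set.univ := by
    refine Set.eq_univ_of_forall fun u => ?_
    obtain ⟨t, ht, htu⟩ := habs u
    obtain ⟨n, hn⟩ := exists_nat_gt t⁻¹
    have hn1 : (0 : ℝ) < (n : ℝ) + 1 := by positivity
    refine Set.mem_iUnion.2 ⟨n, (Set.mem_smul_set_iff_inv_smul_mem₀ hn1.ne' _ _).2 ?_⟩
    have hle : ((n : ℝ) + 1)⁻¹ ≤ t := by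
      rw [inv_le_comm₀ hn1 ht]; linarith
    have := hconv.smul_mem_of_zero_mem hzero htu
      (t := ((n : ℝ) + 1)⁻¹ / t) ⟨by positivity, (div_le_one ht).2 hle⟩
    rwa [smul_smul, div_mul_cancel₀ _ ht.ne'] at this
  obtain ⟨n, hn⟩ := nonempty_interior_of_iUnion_of_closed
    (fun n : ℕ => hcl.smul_of_ne_zero (c := (n : ℝ) + 1) (by positivity)) hcover
  rw [interior_smul₀ (by positivity : ((n : ℝ) + 1) ≠ 0), Set.smul_set_nonempty] at hn
  obtain ⟨a, ha⟩ := hn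
  obtain ⟨t, ht, hta⟩ := habs (-a)
  have h0 : (0 : G) ∈ interior C := by
    have hmem : (0 : G) ∈ openSegment ℝ a (t • -a) := by
      refine ⟨t / (1 + t), 1 / (1 + t), by positivity, by positivity, by field_simp; ring, ?_⟩
      rw [smul_neg, smul_neg, smul_smul, ← sub_eq_add_neg, ← sub_smul]
      convert zero_smul ℝ a using 2
      ring
    exact hconv.openSegment_interior_self_subset_interior ha hta hmem
  exact Metric.mem_nhds_iff.1 (mem_interior_iff_mem_nhds.1 h0)

/-- Dyadic convex series: if every point of a ball is within half the radius of the projection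
of a bounded closed convex set `K ∋ 0`, then the ball of half the radius lies in the projection. -/
theorem exists_mem_of_ball_approx [CompleteSpace V] {K : Set (V × G)}
    (hconv : Convex ℝ K) (hcl : IsClosed K) (hzero : (0 : V × G) ∈ K)
    (hbdd : ∀ k ∈ K, ‖k.1‖ ≤ 1) {ρ : ℝ}
    (happrox : ∀ u : G, ‖u‖ < ρ → ∃ k ∈ K, ‖u - k.2‖ < ρ / 2)
    {u : G} (hu : ‖u‖ < ρ / 2) : ∃ v, (v, u) ∈ K := by
  have hex : ∀ u : G, ∃ k : V × G, ‖u‖ < ρ → k ∈ K ∧ ‖u - k.2‖ < ρ / 2 := fun u => by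
    by_cases h : ‖u‖ < ρ
    · obtain ⟨k, hk, hk'⟩ := happrox u h
      exact ⟨k, fun _ => ⟨hk, hk'⟩⟩
    · exact ⟨0, fun h' => absurd h' h⟩
  choose κ hκ using hex
  -- Rescaled remainder: `r n = 2 ^ (n + 1) • (u - (s n).2)`, where `s` is the partial sum below.
  let r : ℕ → G := fun n => Nat.rec ((2 : ℝ) • u) (fun _ w => (2 : ℝ) • (w - (κ w).2)) n
  have hr_succ : ∀ n, r (n + 1) = (2 : ℝ) • (r n - (κ (r n)).2) := fun n => rfl
  have hr : ∀ n, ‖r n‖ < ρ := by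
    intro n
    induction n with
    | zero =>
      change ‖(2 : ℝ) • u‖ < ρ
      rw [norm_smul, Real.norm_ofNat]; linarith
    | succ n ih =>
      have := (hκ _ ih).2
      rw [hr_succ, norm_smul, Real.norm_ofNat]; linarith
  let s : ℕ → V × G := fun n =>
    Nat.rec 0 (fun m w => w + ((1 / 2 : ℝ) ^ (m + 1)) • κ (r m)) n
  have hs_succ : ∀ n, s (n + 1) = s n + ((1 / 2 : ℝ) ^ (n + 1)) • κ (r n) := fun n => rfl
  -- The weights used so far leave mass `2⁻ⁿ`, available to any point of `K`; this form makes the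
  -- induction close.
  have hsK : ∀ n, ∀ x ∈ K, s n + ((1 / 2 : ℝ) ^ n) • x ∈ K := by
    intro n
    induction n with
    | zero =>
      intro x hx
      change (0 : V × G) + ((1 / 2 : ℝ) ^ 0) • x ∈ K
      simpa using hx
    | succ n ih =>
      intro x hx
      have hm := ih _ (hconv (hκ _ (hr n)).1 hx (a := 1 / 2) (b := 1 / 2)
        (by norm_num) (by norm_num) (by norm_num))
      rw [smul_add, smul_smul, smul_smul, ← pow_succ, ← add_assoc] at hm
      exact hm
  have hs : ∀ n, s n ∈ K := fun n => by simpa using hsK n 0 hzero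
  have hrem : ∀ n, u - (s n).2 = ((1 / 2 : ℝ) ^ (n + 1)) • r n := by
    intro n
    induction n with
    | zero =>
      change u - 0 = ((1 / 2 : ℝ) ^ (0 + 1)) • ((2 : ℝ) • u)
      rw [smul_smul]; norm_num
    | succ n ih =>
      rw [hs_succ, Prod.snd_add, Prod.smul_snd, ← sub_sub, ih, hr_succ, smul_smul, pow_succ _ (n + 1),
        mul_assoc, show (1 / 2 : ℝ) * 2 = 1 by norm_num, mul_one, smul_sub]
  have hcauchy : CauchySeq fun n => (s n).1 := by
    refine cauchySeq_of_le_geometric_two (C := 1) fun n => ?_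
    rw [dist_eq_norm, hs_succ, Prod.fst_add, Prod.smul_fst, sub_add_cancel_left, norm_neg, norm_smul]
    have := hbdd _ (hκ _ (hr n)).1
    rw [Real.norm_of_nonneg (by positivity), div_div, ← pow_succ', one_div_pow]
    calc 1 / 2 ^ (n + 1) * ‖(κ (r n)).1‖ ≤ 1 / 2 ^ (n + 1) * 1 := by gcongr
      _ = _ := mul_one _
  obtain ⟨v, hv⟩ := cauchySeq_tendsto_of_complete hcauchy
  have hlim : Filter.Tendsto (fun n => (s n).2) Filter.atTop (nhds u) := by
    rw [tendsto_iff_norm_sub_tendsto_zero]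
    refine squeeze_zero (g := fun n => (1 / 2 : ℝ) ^ n * ρ) (fun _ => norm_nonneg _) (fun n => ?_) ?_
    · rw [norm_sub_rev, hrem, norm_smul, Real.norm_of_nonneg (by positivity)]
      have h1 : (1 / 2 : ℝ) ^ (n + 1) ≤ (1 / 2) ^ n :=
        pow_le_pow_of_le_one (by norm_num) (by norm_num) (Nat.le_succ n)
      exact mul_le_mul h1 (hr n).le (norm_nonneg _) (by positivity)
    · simpa using (tendsto_pow_atTop_nhds_zero_of_lt_one (r := (1 / 2 : ℝ))
        (by norm_num) (by norm_num)).mul_const ρ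
  exact ⟨v, hcl.mem_of_tendsto (hv.prodMk_nhds hlim) (Filter.Eventually.of_forall hs)⟩

/-- The **Robinson-Ursescu theorem** for a closed convex process, in the form of a bounded
selection near zero. -/
theorem exists_bounded_selection [CompleteSpace V] [CompleteSpace G] {Γ : Set (V × G)}
    (hconv : Convex ℝ Γ) (hcl : IsClosed Γ) {v₀ : V} (hzero : (v₀, (0 : G)) ∈ Γ)
    (habs : ∀ u : G, ∃ t : ℝ, 0 < t ∧ ∃ v, (v, t • u) ∈ Γ) :
    ∃ ρ : ℝ, 0 < ρ ∧ ∀ u : G, ‖u‖ < ρ → ∃ v, ‖v‖ ≤ ‖v₀‖ + 1 ∧ (v, u) ∈ Γ := by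
  -- Truncating in `V` makes the dyadic series converge there; convexity keeps the projection
  -- absorbing.
  let K : Set (V × G) := {k | (k + (v₀, 0)) ∈ Γ} ∩ {k | ‖k.1‖ ≤ 1}
  have hKconv : Convex ℝ K := by
    refine (hconv.translate_preimage_left (v₀, 0)).inter ?_
    have := (convex_closedBall (0 : V) 1).linear_preimage (LinearMap.fst ℝ V G)
    simpa [Set.preimage, Metric.closedBall] using this
  have hKcl : IsClosed K :=
    (hcl.preimage (by fun_prop : Continuous fun k : V × G => k + (v₀, 0))).inter
      (isClosed_le (by fun_prop) continuous_const)
  have hK0 : (0 : V × G) ∈ K := ⟨by simpa using hzero, by simp⟩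
  have hCabs : ∀ u : G, ∃ t : ℝ, 0 < t ∧ t • u ∈ closure (Prod.snd '' K) := by
    intro u
    obtain ⟨t, ht, v, hv⟩ := habs u
    have hpos : 0 < 1 + ‖v - v₀‖ := by positivity
    refine ⟨(1 + ‖v - v₀‖)⁻¹ * t, by positivity, subset_closure
      ⟨(1 + ‖v - v₀‖)⁻¹ • (v - v₀, t • u), ⟨?_, ?_⟩, by simp [smul_smul]⟩⟩
    · have hm : (v - v₀, t • u) + (v₀, (0 : G)) ∈ Γ := by simpa using hv
      have := (hconv.translate_preimage_left (v₀, 0)).smul_mem_of_zero_mem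
        (by simpa using hzero) (x := (v - v₀, t • u)) hm
        (t := (1 + ‖v - v₀‖)⁻¹) ⟨by positivity, inv_le_one_of_one_le₀ (by simp)⟩
      exact this
    · change ‖(1 + ‖v - v₀‖)⁻¹ • (v - v₀)‖ ≤ 1
      rw [norm_smul, Real.norm_of_nonneg (by positivity), inv_mul_le_one₀ hpos]
      simp
  obtain ⟨ρ, hρ, hball⟩ := exists_ball_subset_of_absorbing
    (hKconv.linear_image (LinearMap.snd ℝ V G)).closure isClosed_closure
    (subset_closure ⟨0, hK0, rfl⟩) hCabs
  refine ⟨ρ / 2, by positivity, fun u hu => ?_⟩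
  obtain ⟨v, hv⟩ := exists_mem_of_ball_approx hKconv hKcl hK0 (fun k hk => hk.2) (ρ := ρ)
    (fun w hw => by
      obtain ⟨_, ⟨k, hk, rfl⟩, hk'⟩ := Metric.mem_closure_iff.1
        (hball (mem_ball_zero_iff.2 hw)) (ρ / 2) (by positivity)
      exact ⟨k, hk, by rw [← dist_eq_norm]; exact hk'⟩) hu
  refine ⟨v + v₀, (norm_add_le _ _).trans ?_, by simpa using hv.1⟩
  have : ‖v‖ ≤ 1 := hv.2
  linarith

end ClosedConvexProcesses

/-! ### Fenchel duality under a closed-subspace condition. -/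

section FenchelDuality

variable {E : Type*} [NormedAddCommGroup E] [NormedSpace ℝ E]

/-- The **Attouch-Brezis theorem** in terms of epigraphs: `S` and `T` play the role of the
epigraphs of two lower semicontinuous convex functions with nonnegative sum. -/
theorem exists_dual_le_add [CompleteSpace E] {S T : Set (E × ℝ)} (hS : Convex ℝ S)
    (hT : Convex ℝ T) (hScl : IsClosed S) (hTcl : IsClosed T) {L : Submodule ℝ E}
    (hL : IsClosed (L : Set E)) (hsub : ∀ p ∈ S, ∀ q ∈ T, p.1 - q.1 ∈ L)
    (habs : ∀ u ∈ L, ∃ t : ℝ, 0 < t ∧ ∃ p ∈ S, ∃ q ∈ T, p.1 - q.1 = t • u)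
    (hnonneg : ∀ x s t, (x, s) ∈ S → (x, t) ∈ T → 0 ≤ s + t) :
    ∃ φ : StrongDual ℝ E, ∀ p ∈ S, ∀ q ∈ T, φ (p.1 - q.1) ≤ p.2 + q.2 := by
  have : CompleteSpace L := hL.completeSpace_coe
  let Γ : Set ((E × ℝ × ℝ) × L) := {k | (k.1.1, k.1.2.1) ∈ S ∧ (k.1.1 - (k.2 : E), k.1.2.2) ∈ T}
  have hΓconv : Convex ℝ Γ := by
    rintro ⟨⟨x, s, t⟩, u⟩ ⟨h1, h2⟩ ⟨⟨x', s', t'⟩, u'⟩ ⟨h1', h2'⟩ a b ha hb hab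
    refine ⟨hS h1 h1' ha hb hab, ?_⟩
    convert hT h2 h2' ha hb hab using 1
    ext
    · simp only [Prod.smul_mk, Prod.mk_add_mk, Submodule.coe_add, Submodule.coe_smul, smul_sub]
      abel
    · rfl
  have hΓcl : IsClosed Γ :=
    (hScl.preimage (by fun_prop : Continuous fun k : (E × ℝ × ℝ) × L => (k.1.1, k.1.2.1))).inter
      (hTcl.preimage
        (by fun_prop : Continuous fun k : (E × ℝ × ℝ) × L => (k.1.1 - (k.2 : E), k.1.2.2)))
  obtain ⟨_, -, ⟨x₀, s₀⟩, hp₀, ⟨y₀, t₀⟩, hq₀, h₀⟩ := habs 0 L.zero_mem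
  have hxy : x₀ = y₀ := by simpa [sub_eq_zero] using h₀
  subst hxy
  obtain ⟨ρ, hρ, hsel⟩ := exists_bounded_selection hΓconv hΓcl (v₀ := (x₀, s₀, t₀))
    ⟨hp₀, by simpa using hq₀⟩ (fun u => by
      obtain ⟨t, ht, ⟨x, s⟩, hp, ⟨y, r⟩, hq, h⟩ := habs u u.2
      refine ⟨t, ht, (x, s, r), hp, ?_⟩
      have : x - ((t • u : L) : E) = y := by rw [Submodule.coe_smul, ← h]; simp
      simpa only [this] using hq)
  -- The factor 2 appears because `s` and `t` are each bounded by the norm of the selected triple.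
  set R : ℝ := 2 * (‖(x₀, s₀, t₀)‖ + 1)
  have hRpos : 0 < R := by positivity
  -- Strict epigraph of the value function `u ↦ inf {s + t}` over pairs with difference `u`. The
  -- bounded selection gives it interior, and nonnegativity keeps zero out.
  let W : Set (L × ℝ) := {w | ∃ p ∈ S, ∃ q ∈ T, p.1 - q.1 = (w.1 : E) ∧ p.2 + q.2 < w.2}
  have hWconv : Convex ℝ W := by
    rintro ⟨u, r⟩ ⟨p, hp, q, hq, h, hr⟩ ⟨u', r'⟩ ⟨p', hp', q', hq', h', hr'⟩ a b ha hb hab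
    refine ⟨_, hS hp hp' ha hb hab, _, hT hq hq' ha hb hab, ?_, ?_⟩
    · simp only [Prod.fst_add, Prod.smul_fst, Submodule.coe_add, Submodule.coe_smul] at h h' ⊢
      rw [← h, ← h', smul_sub, smul_sub]; abel
    · simp only [Prod.snd_add, Prod.smul_snd, smul_eq_mul] at hr hr' ⊢
      rcases ha.eq_or_lt with rfl | ha
      · have : b = 1 := by linarith
        subst this; linarith
      · have h1 := mul_lt_mul_of_pos_left hr ha
        have h2 := mul_le_mul_of_nonneg_left hr'.le hb
        linarith
  have hWint : ∀ u : L, ‖u‖ < ρ → ∀ r, R < r → (u, r) ∈ interior W := by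
    intro u hu r hr
    refine mem_interior.2 ⟨Metric.ball 0 ρ ×ˢ Set.Ioi R, ?_, Metric.isOpen_ball.prod isOpen_Ioi,
      mem_ball_zero_iff.2 hu, hr⟩
    rintro ⟨w, r'⟩ ⟨hw, hr'⟩
    obtain ⟨⟨x, s, t⟩, hv, h1, h2⟩ := hsel w (mem_ball_zero_iff.1 hw)
    refine ⟨_, h1, _, h2, by simp, ?_⟩
    have hs : s ≤ ‖(x, s, t)‖ :=
      (le_abs_self s).trans ((norm_fst_le (s, t)).trans (norm_snd_le (x, s, t)))
    have ht : t ≤ ‖(x, s, t)‖ :=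
      (le_abs_self t).trans ((norm_snd_le (s, t)).trans (norm_snd_le (x, s, t)))
    have : R < r' := hr'
    simp only
    linarith
  have h0 : (0 : L × ℝ) ∉ interior W := fun h => by
    obtain ⟨⟨x, s⟩, hp, ⟨y, t⟩, hq, h, hr⟩ := interior_subset h
    have : x = y := by simpa [sub_eq_zero] using h
    subst this
    exact absurd (hnonneg x s t hp hq) (not_le.2 hr)
  obtain ⟨f, hf⟩ := geometric_hahn_banach_open_point hWconv.interior isOpen_interior h0
  have hfW : ∀ w ∈ W, f w ≤ 0 := by
    intro w hw
    have hcl : w ∈ closure (interior W) := by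
      rw [hWconv.closure_interior_eq_closure_of_nonempty_interior
        ⟨_, hWint 0 (by simpa using hρ) (R + 1) (by linarith)⟩]
      exact subset_closure hw
    exact closure_minimal (fun a ha => by simpa using (hf a ha).le)
      (isClosed_le f.continuous continuous_const) hcl
  set c : ℝ := f (0, 1) with hc
  have hfc : ∀ u r, f (u, r) = f (u, 0) + r * c := by
    intro u r
    have : ((u, r) : L × ℝ) = (u, 0) + r • (0, 1) := by simp
    rw [this, map_add, map_smul, smul_eq_mul]
  -- The separating hyperplane is not vertical, so dividing by `-c` yields a subgradient on `L`.
  have hcneg : c < 0 := by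
    have h1 := hf _ (hWint 0 (by simpa using hρ) (R + 1) (by linarith))
    rw [hfc, map_zero, show ((0 : L), (0 : ℝ)) = 0 from rfl, map_zero, zero_add] at h1
    by_contra hge
    have := mul_nonneg (by linarith : 0 ≤ R + 1) (not_lt.1 hge)
    linarith
  obtain ⟨φ, hφ, -⟩ := exists_extension_norm_eq L
    ((-c)⁻¹ • f.comp (ContinuousLinearMap.inl ℝ L ℝ))
  refine ⟨φ, fun p hp q hq => le_of_forall_pos_le_add fun ε hε => ?_⟩
  have hw := hfW (⟨p.1 - q.1, hsub p hp q hq⟩, p.2 + q.2 + ε) ⟨p, hp, q, hq, rfl, by simpa using hε⟩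
  rw [hfc] at hw
  have hval := hφ ⟨p.1 - q.1, hsub p hp q hq⟩
  simp only [smul_apply, ContinuousLinearMap.comp_apply,
    ContinuousLinearMap.inl_apply, smul_eq_mul] at hval
  rw [hval, inv_mul_le_iff₀ (by linarith)]
  linarith

end FenchelDuality

end MaxMonotone

namespace MaxMonotone

/-! ### Maximal monotone sets and their Fitzpatrick functions. -/

section MaximalMonotoneSets

variable {X : Type*} [NormedAddCommGroup X] [NormedSpace ℝ X]

/-- A maximal monotone subset of `X × X*`. -/
structure IsMaximalMonotoneSet (G : Set (X × StrongDual ℝ X)) : Prop where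
  monotone : ∀ p ∈ G, ∀ q ∈ G, 0 ≤ (p.2 - q.2) (p.1 - q.1)
  mem : ∀ p, (∀ q ∈ G, 0 ≤ (p.2 - q.2) (p.1 - q.1)) → p ∈ G

/-- The epigraph of the Fitzpatrick function of a set `G`. -/
def fitzpatrickEpi (G : Set (X × StrongDual ℝ X)) : Set ((X × StrongDual ℝ X) × ℝ) :=
  {e | ∀ a ∈ G, a.2 e.1.1 + e.1.2 a.1 - a.2 a.1 ≤ e.2}

/-- The reflection `(x, x*) ↦ (x, -x*)`. -/
def reflect (p : X × StrongDual ℝ X) : X × StrongDual ℝ X := (p.1, -p.2)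

theorem IsMaximalMonotone.gra_isMaximalMonotoneSet {A : X → Set (StrongDual ℝ X)}
    (hA : IsMaximalMonotone A) : IsMaximalMonotoneSet (gra A) := by
  refine ⟨hA.1, fun p hp => ?_⟩
  let A' : X → Set (StrongDual ℝ X) := fun x => {x' | x' ∈ A x ∨ (x, x') = p}
  have hgra : ∀ q, q ∈ gra A' ↔ q ∈ gra A ∨ q = p := fun q => Iff.rfl
  have hA' : IsMonotone A' := by
    intro q hq r hr
    rcases (hgra q).1 hq with hq' | rfl <;>
      rcases (hgra r).1 hr with hr' | rfl
    · exact hA.1 q hq' r hr'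
    · have := hp q hq'
      rwa [← neg_sub q.2, ← neg_sub q.1, map_neg, neg_apply, neg_neg] at this
    · exact hp r hr'
    · simp
  rw [← hA.2 A' hA' fun q hq => Or.inl hq]
  exact Or.inr rfl

theorem mem_gra_neg {B : X → Set (StrongDual ℝ X)} {p : X × StrongDual ℝ X} :
    p ∈ gra (-B) ↔ reflect p ∈ gra B := Iff.rfl

theorem convex_fitzpatrickEpi (G : Set (X × StrongDual ℝ X)) : Convex ℝ (fitzpatrickEpi G) := by
  rintro ⟨p, s⟩ hp ⟨q, t⟩ hq a b ha hb hab c hc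
  have h1 := mul_le_mul_of_nonneg_left (hp c hc) ha
  have h2 := mul_le_mul_of_nonneg_left (hq c hc) hb
  simp only [Prod.smul_mk, Prod.mk_add_mk, Prod.fst_add, Prod.snd_add, Prod.smul_fst, Prod.smul_snd,
    map_add, map_smul, add_apply, smul_apply, smul_eq_mul] at h1 h2 ⊢
  have h3 : c.2 c.1 = a * c.2 c.1 + b * c.2 c.1 := by rw [← add_mul, hab, one_mul]
  linarith

theorem isClosed_fitzpatrickEpi (G : Set (X × StrongDual ℝ X)) : IsClosed (fitzpatrickEpi G) := by
  have : fitzpatrickEpi G = ⋂ a ∈ G, {e | a.2 e.1.1 + e.1.2 a.1 - a.2 a.1 ≤ e.2} := by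
    ext e; simp [fitzpatrickEpi]
  rw [this]
  refine isClosed_biInter fun a _ => isClosed_le ?_ continuous_snd
  fun_prop

theorem mem_dom_fitzpatrick {A : X → Set (StrongDual ℝ X)} {p : X × StrongDual ℝ X} :
    p ∈ dom (fitzpatrick A) ↔ ∃ s : ℝ, (p, s) ∈ fitzpatrickEpi (gra A) := by
  have key : ∀ s : ℝ, fitzpatrick A p ≤ (s : EReal) ↔ (p, s) ∈ fitzpatrickEpi (gra A) := by
    intro s
    simp only [fitzpatrick, fitzpatrickEpi, iSup₂_le_iff, EReal.coe_le_coe_iff, Set.mem_ofPred_eq]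
  simp only [← key]
  constructor
  · intro h
    obtain ⟨s, hs, -⟩ := EReal.lt_iff_exists_real_btwn.1 h
    exact ⟨s, hs.le⟩
  · rintro ⟨s, hs⟩
    exact hs.trans_lt (EReal.coe_lt_top s)

namespace IsMaximalMonotoneSet

variable {G : Set (X × StrongDual ℝ X)} (hG : IsMaximalMonotoneSet G)
include hG

theorem mem_fitzpatrickEpi {p : X × StrongDual ℝ X} (hp : p ∈ G) :
    (p, p.2 p.1) ∈ fitzpatrickEpi G := by
  intro a ha
  have := hG.monotone p hp a ha
  simp only [map_sub, sub_apply] at this ⊢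
  linarith

theorem mem_of_mem_fitzpatrickEpi {p : X × StrongDual ℝ X} {s : ℝ} (hp : (p, s) ∈ fitzpatrickEpi G)
    (hs : s ≤ p.2 p.1) : p ∈ G := by
  refine hG.mem p fun a ha => ?_
  have := hp a ha
  simp only [map_sub, sub_apply] at this ⊢
  linarith

/-- If `s` were below the pairing, `p` would belong to `G`; testing the Fitzpatrick inequality at
`p` itself is then a contradiction. -/
theorem le_of_mem_fitzpatrickEpi {p : X × StrongDual ℝ X} {s : ℝ}
    (hp : (p, s) ∈ fitzpatrickEpi G) : p.2 p.1 ≤ s := by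
  by_contra! h
  have := hp p (hG.mem_of_mem_fitzpatrickEpi hp h.le)
  simp only at this
  linarith

/-- Translates of maximal monotone sets are maximal monotone. -/
theorem preimage_add (z : X × StrongDual ℝ X) : IsMaximalMonotoneSet {p | p + z ∈ G} := by
  refine ⟨fun p hp q hq => ?_, fun p hp => hG.mem _ fun q hq => ?_⟩
  · simpa using hG.monotone _ hp _ hq
  · have := hp (q - z) (by simpa using hq)
    rw [Prod.fst_sub, Prod.snd_sub, sub_sub_eq_add_sub, sub_sub_eq_add_sub] at this
    exact this

/-- Against any `q ∈ G`, the terms linear in `t` cancel by constancy and the quadratic term is `t ^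
2 * w' w ≥ 0`; maximality applies. -/
theorem add_smul_mem {w : X} {w' : StrongDual ℝ X} {c : ℝ}
    (hconst : ∀ p ∈ G, w' p.1 + p.2 w = c) (hw : 0 ≤ w' w) {p : X × StrongDual ℝ X} (hp : p ∈ G)
    (t : ℝ) : p + t • (w, w') ∈ G := by
  refine hG.mem _ fun q hq => ?_
  have h1 := hG.monotone p hp q hq
  have h2 := hconst p hp
  have h3 := hconst q hq
  have h4 : 0 ≤ t * (t * w' w) := by rw [← mul_assoc]; exact mul_nonneg (mul_self_nonneg t) hw
  have h5 : t * (w' p.1 + p.2 w) = t * (w' q.1 + q.2 w) := by rw [h2, h3]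
  simp only [Prod.fst_add, Prod.snd_add, Prod.smul_mk, map_sub, map_add, map_smul, sub_apply,
    add_apply, smul_apply, smul_eq_mul] at h1 ⊢
  linarith

/-- Moving by `(w, w')` stays in `G` but changes the constant by `2 * w' w`. -/
theorem apply_eq_zero_of_const (hne : G.Nonempty) {w : X} {w' : StrongDual ℝ X} {c : ℝ}
    (hconst : ∀ p ∈ G, w' p.1 + p.2 w = c) (hw : 0 ≤ w' w) : w' w = 0 := by
  obtain ⟨p, hp⟩ := hne
  have h1 := hconst _ (hG.add_smul_mem hconst hw hp 1)
  have h2 := hconst p hp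
  simp only [one_smul, Prod.fst_add, Prod.snd_add, map_add, add_apply] at h1
  linarith

/-- A hyperplane containing a maximal monotone set, with isotropic normal, contains the domain
of the Fitzpatrick function. -/
theorem eq_of_mem_fitzpatrickEpi (hne : G.Nonempty) {w : X} {w' : StrongDual ℝ X} {c : ℝ}
    (hconst : ∀ p ∈ G, w' p.1 + p.2 w = c) (hw : w' w = 0) {p : X × StrongDual ℝ X} {s : ℝ}
    (hp : (p, s) ∈ fitzpatrickEpi G) : w' p.1 + p.2 w = c := by
  obtain ⟨a, ha⟩ := hne
  have hca := hconst a ha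
  set M : ℝ := s - (a.2 p.1 + p.2 a.1 - a.2 a.1)
  set d : ℝ := w' p.1 + p.2 w - c with hd
  -- Test against the whole line `a + t • (w, w')` in `G`; a bound for all real `t` forces `d = 0`.
  have key : ∀ t : ℝ, t * d ≤ M := by
    intro t
    have := hp _ (hG.add_smul_mem hconst hw.ge ha t)
    simp only [Prod.fst_add, Prod.snd_add, Prod.smul_mk, map_add, map_smul, add_apply, smul_apply,
      smul_eq_mul, hw, mul_zero, add_zero] at this
    rw [hd, ← hca]
    simp only [M]
    linarith
  by_contra hne'
  have hd0 : d ≠ 0 := sub_ne_zero.2 hne'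
  have := key ((M + 1) / d)
  rw [div_mul_cancel₀ _ hd0] at this
  linarith

end IsMaximalMonotoneSet

/-- On a reflexive space every functional on `X × X*` comes from a point of `X × X*`. -/
theorem IsReflexive.exists_pair (hX : IsReflexive X) (φ : StrongDual ℝ (X × StrongDual ℝ X)) :
    ∃ (w : X) (w' : StrongDual ℝ X), ∀ p, φ p = w' p.1 + p.2 w := by
  obtain ⟨w, hw⟩ := hX (φ.comp (ContinuousLinearMap.inr ℝ X (StrongDual ℝ X)))
  refine ⟨w, φ.comp (ContinuousLinearMap.inl ℝ X (StrongDual ℝ X)), fun p => ?_⟩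
  have h := congrArg (fun ψ => ψ p.2) hw
  simp only [NormedSpace.dual_def, ContinuousLinearMap.comp_apply,
    ContinuousLinearMap.inr_apply] at h
  rw [h, ContinuousLinearMap.comp_apply, ContinuousLinearMap.inl_apply, ← map_add]
  simp

theorem mem_fitzpatrickEpi_preimage_add {G : Set (X × StrongDual ℝ X)} {p z : X × StrongDual ℝ X}
    {s : ℝ} (h : (p, s) ∈ fitzpatrickEpi G) :
    (p - z, s - z.2 p.1 - p.2 z.1 + z.2 z.1) ∈ fitzpatrickEpi {q | q + z ∈ G} := by
  intro a ha
  have := h _ ha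
  simp only [Prod.fst_add, Prod.snd_add, Prod.fst_sub, Prod.snd_sub, map_add, map_sub, add_apply,
    sub_apply] at this ⊢
  linarith

theorem exists_mem_fitzpatrickEpi_of_preimage_add {G : Set (X × StrongDual ℝ X)}
    {p z : X × StrongDual ℝ X} {s : ℝ} (h : (p, s) ∈ fitzpatrickEpi {q | q + z ∈ G}) :
    ∃ t, (p + z, t) ∈ fitzpatrickEpi G := by
  have := mem_fitzpatrickEpi_preimage_add (z := -z) h
  have hset : {q : X × StrongDual ℝ X | q + -z ∈ {q | q + z ∈ G}} = G := by
    ext q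
    change q + -z + z ∈ G ↔ q ∈ G
    rw [neg_add_cancel_right]
  rw [hset, sub_neg_eq_add] at this
  exact ⟨_, this⟩

/-- If zero lies in the intrinsic core of the difference of the domains of the Fitzpatrick
functions of `G` and (reflected) `H`, then `G` meets the reflection of `H`. -/
theorem exists_mem_reflect_mem [CompleteSpace X] (hX : IsReflexive X)
    {G H : Set (X × StrongDual ℝ X)} (hG : IsMaximalMonotoneSet G) (hH : IsMaximalMonotoneSet H)
    {L : Submodule ℝ (X × StrongDual ℝ X)} (hL : IsClosed (L : Set (X × StrongDual ℝ X)))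
    (hsub : ∀ p s q t, (p, s) ∈ fitzpatrickEpi G → (reflect q, t) ∈ fitzpatrickEpi H → p - q ∈ L)
    (habs : ∀ u ∈ L, ∃ r : ℝ, 0 < r ∧ ∃ p s q t, (p, s) ∈ fitzpatrickEpi G ∧
      (reflect q, t) ∈ fitzpatrickEpi H ∧ p - q = r • u) :
    ∃ p ∈ G, reflect p ∈ H := by
  have hTconv : Convex ℝ {e : (X × StrongDual ℝ X) × ℝ | (reflect e.1, e.2) ∈ fitzpatrickEpi H} := by
    intro e he e' he' a b ha hb hab
    have := convex_fitzpatrickEpi H he he' ha hb hab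
    simpa [reflect, add_comm] using this
  have hTcl : IsClosed {e : (X × StrongDual ℝ X) × ℝ | (reflect e.1, e.2) ∈ fitzpatrickEpi H} :=
    (isClosed_fitzpatrickEpi H).preimage (by unfold reflect; fun_prop)
  obtain ⟨φ, hφ⟩ := exists_dual_le_add (convex_fitzpatrickEpi G) hTconv (isClosed_fitzpatrickEpi G)
    hTcl hL (fun p hp q hq => hsub p.1 p.2 q.1 q.2 hp hq)
    (fun u hu => by
      obtain ⟨r, hr, p, s, q, t, hp, hq, h⟩ := habs u hu
      exact ⟨r, hr, (p, s), hp, (q, t), hq, h⟩)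
    (fun x s t hs ht => by
      have h1 := hG.le_of_mem_fitzpatrickEpi hs
      have h2 := hH.le_of_mem_fitzpatrickEpi ht
      simp only [reflect, neg_apply] at h2
      linarith)
  obtain ⟨w, w', hw⟩ := hX.exists_pair φ
  -- The suprema of the two brackets are `F_G (w, w')` and `F_H (w, -w')`. Fixing one variable
  -- bounds the other function, which avoids suprema.
  have key : ∀ p ∈ G, ∀ q ∈ H,
      (p.2 w + w' p.1 - p.2 p.1) + (q.2 w + (-w') q.1 - q.2 q.1) ≤ 0 := by
    intro p hp q hq
    have := hφ _ (hG.mem_fitzpatrickEpi hp) (reflect q, q.2 q.1)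
      (by simpa [reflect] using hH.mem_fitzpatrickEpi hq)
    rw [hw] at this
    simp only [reflect, Prod.fst_sub, Prod.snd_sub, map_sub, sub_apply, neg_apply] at this ⊢
    linarith
  refine ⟨(w, w'), ?_, ?_⟩
  · refine hG.mem_of_mem_fitzpatrickEpi (s := w' w) (fun p hp => ?_) le_rfl
    have : ((w, -w'), -(p.2 w + w' p.1 - p.2 p.1)) ∈ fitzpatrickEpi H := fun q hq => by
      have := key p hp q hq
      simp only
      linarith
    have := hH.le_of_mem_fitzpatrickEpi this
    simp only [neg_apply] at this ⊢
    linarith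
  · refine hH.mem_of_mem_fitzpatrickEpi (s := (-w') w) (fun q hq => ?_) le_rfl
    have : ((w, w'), -(q.2 w + (-w') q.1 - q.2 q.1)) ∈ fitzpatrickEpi G := fun p hp => by
      have := key p hp q hq
      simp only
      linarith
    have := hG.le_of_mem_fitzpatrickEpi this
    simp only [reflect, neg_apply] at this ⊢
    linarith

end MaximalMonotoneSets

end MaxMonotone

namespace MaxMonotone

/-! ### Intrinsic cores and separation from closed affine subspaces. -/

section IntrinsicCore

variable {E : Type*} [NormedAddCommGroup E] [NormedSpace ℝ E]

theorem mem_affineSpan_sub_self {D : Set E} (hD : D.Nonempty) {x : E} :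
    x ∈ affineSpan ℝ (D - D) ↔ x ∈ vectorSpan ℝ D := by
  obtain ⟨d, hd⟩ := hD
  have h0 : (0 : E) ∈ D - D := ⟨d, hd, d, hd, sub_self d⟩
  rw [← AffineSubspace.vsub_right_mem_direction_iff_mem (mem_affineSpan ℝ h0), direction_affineSpan,
    vectorSpan_eq_span_vsub_set_right ℝ h0, vectorSpan_def,
    show D -ᵥ D = D - D from rfl]
  simp

theorem mem_ic {D : Set E} {a : E} :
    a ∈ ic D ↔ IsClosed (affineSpan ℝ D : Set E) ∧ a ∈ D ∧
      ∀ x ∈ vectorSpan ℝ D, ∃ δ : ℝ, 0 < δ ∧ ∀ t ∈ Set.Icc 0 δ, a + t • x ∈ D := by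
  refine and_congr_right fun _ => and_congr_right fun ha => ?_
  simp only [mem_affineSpan_sub_self ⟨a, ha⟩]

/-- The intrinsic core of a convex set is algebraically open in the affine hull. -/
theorem add_smul_mem_ic {D : Set E} (hD : Convex ℝ D) {a x : E} (ha : a ∈ ic D)
    (hx : x ∈ vectorSpan ℝ D) :
    ∃ δ : ℝ, 0 < δ ∧ ∀ t ∈ Set.Icc 0 δ, a + t • x ∈ ic D := by
  obtain ⟨hcl, haD, hcore⟩ := mem_ic.1 ha
  obtain ⟨δ, hδ, hδx⟩ := hcore x hx
  refine ⟨δ / 2, by positivity, fun t ht => mem_ic.2 ⟨hcl, hδx t ⟨ht.1, by linarith [ht.2]⟩,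
    fun y hy => ?_⟩⟩
  obtain ⟨ε, hε, hεy⟩ := hcore y hy
  refine ⟨ε / 2, by positivity, fun r hr => ?_⟩
  -- `a + t • x + r • y` is the combination of `a + (r / (1 - l)) • y` and `a + δ • x` with weights
  -- `1 - l` and `l`.
  set l : ℝ := t / δ with hl
  have hl0 : 0 ≤ l := div_nonneg ht.1 hδ.le
  have hl1 : l ≤ 1 / 2 := by rw [hl, div_le_iff₀ hδ]; linarith [ht.2]
  have hm : 0 < 1 - l := by linarith
  have hr' : r / (1 - l) ≤ ε := by
    rw [div_le_iff₀ hm]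
    have := mul_le_mul_of_nonneg_left hl1 hε.le
    linarith [hr.2]
  have := hD (hεy _ ⟨div_nonneg hr.1 hm.le, hr'⟩) (hδx δ ⟨hδ.le, le_rfl⟩) hm.le hl0 (by ring)
  convert this using 1
  rw [smul_add, smul_add, smul_smul, smul_smul, mul_div_cancel₀ _ hm.ne', hl,
    div_mul_cancel₀ _ hδ.ne', sub_smul, one_smul]
  abel

/-- `S` need not be convex: from a point of `ic S₂`, short segments stay in `ic S₂` by convexity of
`S₂`, hence in `S₀ ⊆ S`. -/
theorem ic_eq_of_subset_of_subset {S₀ S S₂ : Set E} (h₀ : S₀ ⊆ S) (h₂ : S ⊆ S₂)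
    (hspan : affineSpan ℝ S₂ ≤ affineSpan ℝ S₀) (hconv : Convex ℝ S₂) (hcore : ic S₂ ⊆ S₀) :
    ic S = ic S₂ := by
  have hS : affineSpan ℝ S = affineSpan ℝ S₂ :=
    le_antisymm (affineSpan_mono ℝ h₂) (hspan.trans (affineSpan_mono ℝ h₀))
  have hvec : vectorSpan ℝ S = vectorSpan ℝ S₂ := by
    rw [← direction_affineSpan, hS, direction_affineSpan]
  ext a
  constructor
  · intro ha
    obtain ⟨hcl, haS, h⟩ := mem_ic.1 ha
    refine mem_ic.2 ⟨hS ▸ hcl, h₂ haS, fun x hx => ?_⟩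
    obtain ⟨δ, hδ, hδx⟩ := h x (hvec ▸ hx)
    exact ⟨δ, hδ, fun t ht => h₂ (hδx t ht)⟩
  · intro ha
    refine mem_ic.2 ⟨hS ▸ (mem_ic.1 ha).1, h₀ (hcore ha), fun x hx => ?_⟩
    obtain ⟨δ, hδ, hδx⟩ := add_smul_mem_ic hconv ha (hvec ▸ hx)
    exact ⟨δ, hδ, fun t ht => h₀ (hcore (hδx t ht))⟩

/-- A point outside a closed affine subspace is separated from it by a functional which is constant
on the subspace. -/
theorem exists_dual_const_of_notMem {M : AffineSubspace ℝ E} (hM : IsClosed (M : Set E)) {d m : E}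
    (hm : m ∈ M) (hd : d ∉ M) :
    ∃ φ : StrongDual ℝ E, (∀ p ∈ M, φ p = φ m) ∧ φ d ≠ φ m := by
  obtain ⟨φ, u, hφM, hφd⟩ := geometric_hahn_banach_closed_point M.convex hM hd
  refine ⟨φ, fun p hp => ?_, ((hφM m hm).trans hφd).ne'⟩
  by_contra hne
  have h0 : φ p - φ m ≠ 0 := sub_ne_zero.2 hne
  -- On this point of the line through `m` and `p`, `φ` takes the value `u`, contradicting `φ < u`
  -- on `M`.
  have := hφM _ (AffineMap.lineMap_mem ((u - φ m) / (φ p - φ m)) hm hp)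
  rw [AffineMap.lineMap_apply, vsub_eq_sub, vadd_eq_add, map_add, map_smul, map_sub, smul_eq_mul,
    div_mul_cancel₀ _ h0] at this
  linarith

end IntrinsicCore

/-! ### Domains of representatives. -/

section Representatives

variable {X : Type*} [NormedAddCommGroup X] [NormedSpace ℝ X]

theorem dom_fitzpatrick_convex (A : X → Set (StrongDual ℝ X)) : Convex ℝ (dom (fitzpatrick A)) := by
  intro p hp q hq a b ha hb hab
  obtain ⟨s, hs⟩ := mem_dom_fitzpatrick.1 hp
  obtain ⟨t, ht⟩ := mem_dom_fitzpatrick.1 hq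
  exact mem_dom_fitzpatrick.2 ⟨_, convex_fitzpatrickEpi _ hs ht ha hb hab⟩

theorem dom_hat_fitzpatrick_convex (B : X → Set (StrongDual ℝ X)) :
    Convex ℝ (dom (hat (fitzpatrick B))) := by
  intro p hp q hq a b ha hb hab
  have := dom_fitzpatrick_convex B (x := reflect p) hp (y := reflect q) hq ha hb hab
  change reflect _ ∈ dom (fitzpatrick B)
  simpa [reflect, add_comm] using this

theorem IsMaximalMonotone.gra_subset_dom_fitzpatrick {A : X → Set (StrongDual ℝ X)}
    (hA : IsMaximalMonotone A) : gra A ⊆ dom (fitzpatrick A) := fun _ hp =>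
  mem_dom_fitzpatrick.2 ⟨_, hA.gra_isMaximalMonotoneSet.mem_fitzpatrickEpi hp⟩

namespace IsRepresentative

variable {F : X × StrongDual ℝ X → EReal} {A : X → Set (StrongDual ℝ X)}

theorem gra_subset_dom (hF : IsRepresentative F A) : gra A ⊆ dom F := by
  intro p hp
  rw [hF.gra_eq] at hp
  exact (show F p = _ from hp).trans_lt (EReal.coe_lt_top _)

theorem dom_subset_dom_fitzpatrick (hF : IsRepresentative F A) : dom F ⊆ dom (fitzpatrick A) := by
  intro p hp
  obtain ⟨s, hs, -⟩ := EReal.lt_iff_exists_real_btwn.1 (show F p < ⊤ from hp)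
  refine mem_dom_fitzpatrick.2 ⟨s, fun a ha => ?_⟩
  rw [hF.gra_eq] at ha
  -- Compare `F` with the pairing at `(1 - t) • a + t • p` and divide by `t`; letting `t → 0` gives
  -- `F_A p ≤ s`.
  have key : ∀ t ∈ Set.Ioc (0 : ℝ) 1,
      a.2 p.1 + p.2 a.1 - a.2 a.1 - s ≤ t * (a.2 p.1 + p.2 a.1 - a.2 a.1 - p.2 p.1) := by
    intro t ht
    have hconv := hF.convex (x := (a, a.2 a.1)) (show F a ≤ _ from le_of_eq ha) (y := (p, s)) hs.le
      (sub_nonneg.2 ht.2) ht.1.le (by ring)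
    have h := EReal.coe_le_coe_iff.1 ((hF.le _ _).trans hconv)
    simp only [Prod.smul_mk, Prod.mk_add_mk, Prod.smul_fst, Prod.smul_snd, map_add,
      map_smul, add_apply, smul_apply, smul_eq_mul] at h
    refine le_of_mul_le_mul_left ?_ ht.1
    linarith
  set α := a.2 p.1 + p.2 a.1 - a.2 a.1 - s
  set β := a.2 p.1 + p.2 a.1 - a.2 a.1 - p.2 p.1
  have hα : α ≤ 0 := by
    by_contra! hpos
    have hb : 0 < |β| + 1 := by positivity
    have hm : 0 < min 1 (α / (2 * (|β| + 1))) := by positivity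
    have h1 := key _ ⟨hm, min_le_left _ _⟩
    have h2 : min 1 (α / (2 * (|β| + 1))) * β ≤ α / (2 * (|β| + 1)) * (|β| + 1) :=
      (mul_le_mul_of_nonneg_left ((le_abs_self β).trans (by linarith)) hm.le).trans
        (mul_le_mul_of_nonneg_right (min_le_right _ _) hb.le)
    have h3 : α / (2 * (|β| + 1)) * (|β| + 1) = α / 2 := by field_simp
    linarith
  simp only [α] at hα
  linarith

end IsRepresentative

end Representatives

/-! ### The two inclusions behind the theorem. -/

section Main

variable {X : Type*} [NormedAddCommGroup X] [NormedSpace ℝ X] {A B : X → Set (StrongDual ℝ X)}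

theorem affineSpan_dom_fitzpatrick_sub_le (hX : IsReflexive X) (hA : IsMaximalMonotone A)
    (hB : IsMaximalMonotone B) (hne : (gra A - gra (-B)).Nonempty)
    (hcl : IsClosed (affineSpan ℝ (gra A - gra (-B)) : Set (X × StrongDual ℝ X))) :
    affineSpan ℝ (dom (fitzpatrick A) - dom (hat (fitzpatrick B))) ≤
      affineSpan ℝ (gra A - gra (-B)) := by
  have hG := hA.gra_isMaximalMonotoneSet
  have hH := hB.gra_isMaximalMonotoneSet
  obtain ⟨_, p₀, hp₀, q₀, hq₀, rfl⟩ := hne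
  rw [affineSpan_le]
  rintro _ ⟨p, hp, q, hq, rfl⟩
  by_contra hnot
  obtain ⟨φ, hφ, hφne⟩ := exists_dual_const_of_notMem hcl
    (mem_affineSpan ℝ (Set.sub_mem_sub hp₀ hq₀)) hnot
  obtain ⟨w, w', hw⟩ := hX.exists_pair φ
  have hconstG : ∀ a ∈ gra A, w' a.1 + a.2 w = φ p₀ := fun a ha => by
    have := hφ _ (mem_affineSpan ℝ (Set.sub_mem_sub ha hq₀))
    rw [map_sub, map_sub, sub_left_inj] at this
    rw [← this, hw]
  have hconstH : ∀ b ∈ gra B, w' b.1 + b.2 (-w) = φ q₀ := fun b hb => by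
    have hb' : reflect b ∈ gra (-B) := by
      rw [mem_gra_neg]; simpa [reflect] using hb
    have := hφ _ (mem_affineSpan ℝ (Set.sub_mem_sub hp₀ hb'))
    rw [map_sub, map_sub, sub_right_inj] at this
    rw [← this, hw]
    simp [reflect]
  -- The normals for `A` and `B` are `(w, w')` and `(-w, w')`, with opposite pairings, so one of the
  -- two graphs always applies.
  have hzero : w' w = 0 := by
    rcases le_total 0 (w' w) with h | h
    · exact hG.apply_eq_zero_of_const ⟨_, hp₀⟩ hconstG h
    · have := hH.apply_eq_zero_of_const ⟨_, mem_gra_neg.1 hq₀⟩ hconstH (by simpa using h)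
      simpa using this
  obtain ⟨s, hs⟩ := mem_dom_fitzpatrick.1 hp
  obtain ⟨t, ht⟩ := mem_dom_fitzpatrick.1 (show reflect q ∈ dom (fitzpatrick B) from hq)
  have h1 := hG.eq_of_mem_fitzpatrickEpi ⟨_, hp₀⟩ hconstG hzero hs
  have h2 := hH.eq_of_mem_fitzpatrickEpi ⟨_, mem_gra_neg.1 hq₀⟩ hconstH (by simpa using hzero) ht
  refine hφne ?_
  rw [map_sub, map_sub, ← h1, ← h2, hw, hw]
  simp [reflect]

theorem ic_dom_fitzpatrick_sub_subset [CompleteSpace X] (hX : IsReflexive X)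
    (hA : IsMaximalMonotone A) (hB : IsMaximalMonotone B) :
    ic (dom (fitzpatrick A) - dom (hat (fitzpatrick B))) ⊆ gra A - gra (-B) := by
  intro z hz
  obtain ⟨hcl, hzD, hcore⟩ := mem_ic.1 hz
  set D := dom (fitzpatrick A) - dom (hat (fitzpatrick B))
  have hL : IsClosed (vectorSpan ℝ D : Set (X × StrongDual ℝ X)) := by
    rw [← direction_affineSpan, AffineSubspace.isClosed_direction_iff]
    exact hcl
  obtain ⟨p, hp, hp'⟩ := exists_mem_reflect_mem hX
    (hA.gra_isMaximalMonotoneSet.preimage_add z) hB.gra_isMaximalMonotoneSet hL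
    (fun p s q t hp hq => by
      obtain ⟨s', hs'⟩ := exists_mem_fitzpatrickEpi_of_preimage_add hp
      have hmem : p + z - q ∈ D :=
        Set.sub_mem_sub (mem_dom_fitzpatrick.2 ⟨s', hs'⟩) (mem_dom_fitzpatrick.2 ⟨t, hq⟩)
      have := vsub_mem_vectorSpan ℝ hmem hzD
      rwa [vsub_eq_sub, show p + z - q - z = p - q by abel] at this)
    (fun u hu => by
      obtain ⟨δ, hδ, h⟩ := hcore u hu
      obtain ⟨p, hp, q, hq, hpq⟩ := h δ ⟨hδ.le, le_rfl⟩
      obtain ⟨s, hs⟩ := mem_dom_fitzpatrick.1 hp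
      obtain ⟨t, ht⟩ := mem_dom_fitzpatrick.1 (show reflect q ∈ dom (fitzpatrick B) from hq)
      refine ⟨δ, hδ, p - z, _, q, t, mem_fitzpatrickEpi_preimage_add hs, ht, ?_⟩
      have hpq : p - q = z + δ • u := hpq
      rw [sub_right_comm, hpq, add_sub_cancel_left])
  exact ⟨p + z, hp, p, mem_gra_neg.2 hp', add_sub_cancel_left p z⟩

end Main

end MaxMonotone

theorem theorem2p5 {X : Type*} [NormedAddCommGroup X] [NormedSpace ℝ X] [CompleteSpace X]
    (hX : MaxMonotone.IsReflexive X)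
    (A B : X → Set (StrongDual ℝ X))
    (hA : MaxMonotone.IsMaximalMonotone A) (hB : MaxMonotone.IsMaximalMonotone B)
    (hne : (MaxMonotone.ic
      (convexHull ℝ (MaxMonotone.gra A - MaxMonotone.gra (-B)))).Nonempty) :
    (MaxMonotone.ic (MaxMonotone.gra A - MaxMonotone.gra (-B)) =
        MaxMonotone.ic (convexHull ℝ (MaxMonotone.gra A - MaxMonotone.gra (-B))) ∧
      MaxMonotone.ic (convexHull ℝ (MaxMonotone.gra A - MaxMonotone.gra (-B))) =
        MaxMonotone.ic (MaxMonotone.dom (MaxMonotone.fitzpatrick A) -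
          MaxMonotone.dom (MaxMonotone.hat (MaxMonotone.fitzpatrick B)))) ∧
    ∀ F₁ F₂ : X × StrongDual ℝ X → EReal,
      MaxMonotone.IsRepresentative F₁ A → MaxMonotone.IsRepresentative F₂ B →
        MaxMonotone.ic (MaxMonotone.dom F₁ - MaxMonotone.dom (MaxMonotone.hat F₂)) =
            MaxMonotone.ic (convexHull ℝ (MaxMonotone.gra A - MaxMonotone.gra (-B))) ∧
          MaxMonotone.ic (convexHull ℝ (MaxMonotone.gra A - MaxMonotone.gra (-B))) =
            MaxMonotone.ic (MaxMonotone.dom (MaxMonotone.fitzpatrick A) -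
              MaxMonotone.dom (MaxMonotone.hat (MaxMonotone.fitzpatrick B))) := by

  have hne₀ : (MaxMonotone.gra A - MaxMonotone.gra (-B)).Nonempty := by
    obtain ⟨a, ha⟩ := hne
    exact convexHull_nonempty_iff.1 ⟨a, ha.2.1⟩
  have hcl : IsClosed (affineSpan ℝ (MaxMonotone.gra A - MaxMonotone.gra (-B)) :
      Set (X × StrongDual ℝ X)) := by
    rw [← affineSpan_convexHull]
    exact hne.some_mem.1
  have hspan := MaxMonotone.affineSpan_dom_fitzpatrick_sub_le hX hA hB hne₀ hcl
  have hcore := MaxMonotone.ic_dom_fitzpatrick_sub_subset hX hA hB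
  have hconv := (MaxMonotone.dom_fitzpatrick_convex A).sub
    (MaxMonotone.dom_hat_fitzpatrick_convex B)
  have hsub : MaxMonotone.gra A - MaxMonotone.gra (-B) ⊆
      MaxMonotone.dom (MaxMonotone.fitzpatrick A) -
        MaxMonotone.dom (MaxMonotone.hat (MaxMonotone.fitzpatrick B)) :=
    Set.sub_subset_sub hA.gra_subset_dom_fitzpatrick
      fun _ hq => hB.gra_subset_dom_fitzpatrick (MaxMonotone.mem_gra_neg.1 hq)
  have h₀ := MaxMonotone.ic_eq_of_subset_of_subset subset_rfl hsub hspan hconv hcore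
  have h₁ := MaxMonotone.ic_eq_of_subset_of_subset (subset_convexHull ℝ _)
    (convexHull_min hsub hconv) hspan hconv hcore
  refine ⟨⟨h₀.trans h₁.symm, h₁⟩, fun F₁ F₂ hF₁ hF₂ => ⟨?_, h₁⟩⟩
  refine Eq.trans (MaxMonotone.ic_eq_of_subset_of_subset ?_ ?_ hspan hconv hcore) h₁.symm
  · exact Set.sub_subset_sub hF₁.gra_subset_dom
      fun _ hq => hF₂.gra_subset_dom (MaxMonotone.mem_gra_neg.1 hq)
  · exact Set.sub_subset_sub hF₁.dom_subset_dom_fitzpatrick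
      fun _ hq => hF₂.dom_subset_dom_fitzpatrick hq
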